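/- Let $q$ be a prime power and let $V$ be a finite-dimensional vector space over the finite field $\mathbb{F}_q$ with $q$ elements. A *subspace partition* of $V$ is a collection $\mathcal{P}$ of nonzero subspaces of $V$ such that each nonzero vector of $V$ lies in exactly one member of $\mathcal{P}$; its *size* is $|\mathcal{P}|$. For an integer $d$, the *$d$-supertail* of $\mathcal{P}$ is the set of members of $\mathcal{P}$ of dimension less than $d$. For $1\le t<n$ let $\sigma_q(n,t)$ be the minimum size of a subspace partition of $\mathbb{F}_q^n$ in which the largest subspace has dimension $t$. Let $\mathcal{P}$ be a subspace partition of $V$, let $d_1<d_2<\dots<d_m$ be the distinct dimensions of the members of $\mathcal{P}$, and let $2\le s<m$. Let $ST$ be the $d_s$-supertail and $\widehat{ST}$ the $d_{s+1}$-supertail of $\mathcal{P}$, and suppose that $|ST|=\sigma_q(d_s,d_{s-1})$. (i) If $2\le s\le 3$, $d_s<2d_{s-1}$, $d_{s+1}<2d_s$, and it is not the case that $s=3$ and $d_3=d_2+d_1$, then $$|\widehat{ST}|\ \ge\ \sigma_q(d_{s+1},d_s)+\sigma_q(d_s,d_{s-1}).$$ (ii) If $d_s\ge 2d_{s-1}$,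 or if $s=3$ and $d_3=d_2+d_1$, then $$|\widehat{ST}|\ \ge\ \sigma_q(d_{s+1},d_s)+\sigma_q(d_s,d_{s-1})-1.$$ -/

import Mathlib

namespace SubspacePartition

/-- A subspace partition of `V`: a collection of nonzero subspaces such that every nonzero vector
of `V` lies in exactly one of them. -/
structure IsSubspacePartition {K V : Type*} [Field K] [AddCommGroup V] [Module K V]
    (P : Finset (Submodule K V)) : Prop where
  ne_bot : ∀ W ∈ P, W ≠ ⊥
  existsUnique_mem : ∀ v : V, v ≠ 0 → ∃! W : Submodule K V, W ∈ P ∧ v ∈ W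

/-- `d 1 < d 2 < ⋯ < d m` are exactly the dimensions that occur in `P`. -/
structure HasDimensions {K V : Type*} [Field K] [AddCommGroup V] [Module K V]
    (P : Finset (Submodule K V)) (m : ℕ) (d : ℕ → ℕ) : Prop where
  strictMonoOn : StrictMonoOn d (Set.Icc 1 m)
  occurs_iff : ∀ k : ℕ, (∃ W ∈ P, Module.finrank K W = k) ↔ ∃ i ∈ Set.Icc 1 m, d i = k

/-- The `k`-supertail of `P`: the members of `P` of dimension less than `k`. -/
noncomputable def supertail {K V : Type*} [Field K] [AddCommGroup V] [Module K V]
    (P : Finset (Submodule K V)) (k : ℕ) : Finset (Submodule K V) :=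
  P.filter fun W => Module.finrank K W < k

/-- `σ_q(n, t)` for the field `K` with `q` elements: the minimum size of a subspace partition of
`K ^ n` in which the largest subspace has dimension `t`. -/
noncomputable def sigma (K : Type*) [Field K] (n t : ℕ) : ℕ :=
  sInf {c : ℕ | ∃ P : Finset (Submodule K (Fin n → K)), IsSubspacePartition P ∧
    (∃ W ∈ P, Module.finrank K W = t) ∧ (∀ W ∈ P, Module.finrank K W ≤ t) ∧ P.card = c}

end SubspacePartition

/-! Give a functional `f` the weight `w(f) = ∑ q^dim W` over the members `W` of `T` on which `f`
vanishes. For pairwise disjoint members, the mean of `w` is `#T` and the mean of `w²` is `w(0) + #T²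
- #T`. Counting points in `ker f` shows that the weights of a partition, and hence of its
`d`-supertail, all agree modulo `q^d`. So with residue `c` each weight is `c` or at least `c + q^d`,
and the moments bound `#T` from below.

These bounds give `#T ≥ extremalSize q d t` (`extremalSize_le`), and field multiplication yields
partitions showing `sigma ≤ extremalSize` (`sigma_le_extremalSize`). Thus the hypothesis on `ST`
forces equality in the lower bound. The residue is then `#ST - 1`, and `card_sup_of_le_weight` makes
the union of `ST` a subspace `U`.

If `dim U = d_s`, replacing `ST` by `U` subtracts the constant `c` from every weight and so
preserves divisibility; the lower bound for the new family is (ii) (`extremalSize_add_card_le`). If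
`dim U > d_s`, a too small `ŜT` either has residue `q^d_{s-1}`, which a member of dimension `d_s`
rules out, or has its size and residue determined, which contradicts divisibility by `q^(d_s+1)`;
this is (i) (`lt_card_of_lt_finrank_sup`). For `s ≤ 3` at most two dimensions occur in `ST`, so `dim
U` can be computed. -/

namespace SubspacePartition

open Module Finset

/-! ### Weights of functionals and their moments. -/

section Weight

variable {K V : Type*} [Field K] [AddCommGroup V] [Module K V]

open Classical in
/-- The number of elements of `W` if the functional `f` vanishes on `W`, and `0` otherwise. -/
noncomputable def blockWeight (W : Submodule K V) (f : Dual K V) : ℕ :=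
  if f ∈ W.dualAnnihilator then Nat.card K ^ finrank K W else 0

/-- The total number of elements of the members of `T` on which the functional `f` vanishes. -/
noncomputable def weight (T : Finset (Submodule K V)) (f : Dual K V) : ℕ :=
  ∑ W ∈ T, blockWeight W f

/-- The weights of `T` are all congruent modulo `q ^ d`. -/
def IsDivisible (T : Finset (Submodule K V)) (d : ℕ) : Prop :=
  ∀ f : Dual K V, weight T f ≡ weight T 0 [MOD Nat.card K ^ d]

/-- `T` consists of nonzero subspaces that meet pairwise trivially. -/
structure IsPartialSpread (T : Finset (Submodule K V)) : Prop where
  ne_bot : ∀ W ∈ T, W ≠ ⊥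
  disjoint : ∀ W ∈ T, ∀ U ∈ T, W ≠ U → Disjoint W U

lemma IsPartialSpread.mono {T T' : Finset (Submodule K V)} (h : IsPartialSpread T)
    (hT : T' ⊆ T) : IsPartialSpread T' :=
  ⟨fun W hW => h.ne_bot W (hT hW), fun W hW U hU => h.disjoint W (hT hW) U (hT hU)⟩

lemma weight_zero (T : Finset (Submodule K V)) :
    weight T 0 = ∑ W ∈ T, Nat.card K ^ finrank K W := by
  simp [weight, blockWeight]

lemma blockWeight_le (W : Submodule K V) (f : Dual K V) :
    blockWeight W f ≤ Nat.card K ^ finrank K W := by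
  unfold blockWeight; split_ifs <;> simp

lemma blockWeight_of_mem {W : Submodule K V} {f : Dual K V} (h : f ∈ W.dualAnnihilator) :
    blockWeight W f = Nat.card K ^ finrank K W := if_pos h

lemma weight_le_weight_zero (T : Finset (Submodule K V)) (f : Dual K V) :
    weight T f ≤ weight T 0 := by
  rw [weight_zero]; exact sum_le_sum fun W _ => blockWeight_le W f

lemma blockWeight_le_weight {T : Finset (Submodule K V)} {W : Submodule K V} (hW : W ∈ T)
    (f : Dual K V) : blockWeight W f ≤ weight T f :=
  single_le_sum (f := fun W => blockWeight W f) (fun _ _ => Nat.zero_le _) hW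

lemma card_dualAnnihilator_mul [FiniteDimensional K V] (W : Submodule K V) :
    Nat.card W.dualAnnihilator * Nat.card K ^ finrank K W = Nat.card K ^ finrank K V := by
  rw [Module.natCard_eq_pow_finrank (K := K), ← pow_add, add_comm,
    Subspace.finrank_add_finrank_dualAnnihilator_eq]

lemma sum_ite_dualAnnihilator (W : Submodule K V) (g : ℕ)
    [Fintype (Dual K V)] [DecidablePred (· ∈ W.dualAnnihilator)] :
    ∑ f : Dual K V, (if f ∈ W.dualAnnihilator then g else 0) = Nat.card W.dualAnnihilator * g := by
  rw [← sum_filter, sum_const, smul_eq_mul]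
  congr 1
  rw [Nat.card_eq_fintype_card, Fintype.card_subtype]

variable [FiniteDimensional K V]

variable [Fintype (Dual K V)]

lemma sum_blockWeight (W : Submodule K V) :
    ∑ f : Dual K V, blockWeight W f = Nat.card K ^ finrank K V := by
  classical
  simp only [blockWeight]
  rw [← card_dualAnnihilator_mul W, ← sum_ite_dualAnnihilator]

lemma sum_blockWeight_mul_self (W : Submodule K V) :
    ∑ f : Dual K V, blockWeight W f * blockWeight W f =
      Nat.card K ^ finrank K V * Nat.card K ^ finrank K W := by
  classical
  rw [← sum_blockWeight W, sum_mul]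
  refine sum_congr rfl fun f _ => ?_
  unfold blockWeight; split_ifs <;> simp

/-- Vanishing on both members means vanishing on `W ⊔ U`, whose dimension is the sum of the two; so
distinct members are uncorrelated. -/
lemma sum_blockWeight_mul_of_disjoint {W U : Submodule K V} (h : Disjoint W U) :
    ∑ f : Dual K V, blockWeight W f * blockWeight U f = Nat.card K ^ finrank K V := by
  classical
  have key := card_dualAnnihilator_mul (W ⊔ U)
  have hr := Submodule.finrank_sup_add_finrank_inf_eq W U
  rw [h.eq_bot, finrank_bot, add_zero] at hr
  rw [← key, hr, pow_add, ← sum_ite_dualAnnihilator]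
  refine sum_congr rfl fun f _ => ?_
  rw [Submodule.dualAnnihilator_sup_eq]
  unfold blockWeight
  by_cases h1 : f ∈ W.dualAnnihilator <;> by_cases h2 : f ∈ U.dualAnnihilator <;>
    simp [h1, h2]

lemma sum_weight (T : Finset (Submodule K V)) :
    ∑ f : Dual K V, weight T f = Nat.card K ^ finrank K V * T.card := by
  simp only [weight]
  rw [sum_comm, sum_congr rfl fun W _ => sum_blockWeight W, sum_const, smul_eq_mul, mul_comm]

/-- The weights summed over the functionals that vanish on a member `W`. -/
lemma IsPartialSpread.sum_blockWeight_mul_weight {T : Finset (Submodule K V)}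
    (hT : IsPartialSpread T) {W : Submodule K V} (hW : W ∈ T) :
    ∑ f : Dual K V, blockWeight W f * weight T f + Nat.card K ^ finrank K V =
      Nat.card K ^ finrank K V * (T.card + Nat.card K ^ finrank K W) := by
  classical
  simp only [weight, mul_sum]
  rw [sum_comm, ← add_sum_erase _ _ hW, sum_blockWeight_mul_self,
    sum_congr rfl (fun U hU => sum_blockWeight_mul_of_disjoint
      (hT.disjoint W hW U (mem_of_mem_erase hU) (ne_of_mem_erase hU).symm)),
    sum_const, smul_eq_mul, ← card_erase_add_one hW]
  ring

lemma IsPartialSpread.sum_weight_mul_self {T : Finset (Submodule K V)} (hT : IsPartialSpread T) :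
    ∑ f : Dual K V, weight T f * weight T f + Nat.card K ^ finrank K V * T.card =
      Nat.card K ^ finrank K V * (weight T 0 + T.card * T.card) := by
  have h1 : ∑ f : Dual K V, weight T f * weight T f =
      ∑ W ∈ T, ∑ f : Dual K V, blockWeight W f * weight T f := by
    rw [sum_comm]
    refine sum_congr rfl fun f _ => ?_
    rw [← sum_mul, weight]
  have h2 : ∑ W ∈ T, (∑ f : Dual K V, blockWeight W f * weight T f + Nat.card K ^ finrank K V) =
      ∑ W ∈ T, Nat.card K ^ finrank K V * (T.card + Nat.card K ^ finrank K W) :=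
    sum_congr rfl fun W hW => hT.sum_blockWeight_mul_weight hW
  rw [sum_add_distrib, sum_const, smul_eq_mul, ← mul_sum, sum_add_distrib, sum_const,
    smul_eq_mul, ← weight_zero] at h2
  rw [h1]
  linarith


end Weight

/-! ### Functionals of maximal weight. -/

section FiniteField

variable {K V : Type*} [Field K] [AddCommGroup V] [Module K V]
variable [Finite K]

lemma two_le_card : 2 ≤ Nat.card K := Finite.one_lt_card

/-- A functional has full weight exactly when it vanishes on all members. -/
lemma weight_eq_weight_zero_iff (T : Finset (Submodule K V)) (f : Dual K V) :
    weight T f = weight T 0 ↔ f ∈ (T.sup id).dualAnnihilator := by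
  have h0 : weight T 0 = ∑ W ∈ T, Nat.card K ^ finrank K W := weight_zero T
  rw [h0, weight, sum_eq_sum_iff_of_le fun W _ => blockWeight_le W f]
  have h1 : ∀ W : Submodule K V, blockWeight W f = Nat.card K ^ finrank K W ↔
      W ≤ LinearMap.ker f := by
    intro W
    unfold blockWeight
    have : Nat.card K ^ finrank K W ≠ 0 := pow_ne_zero _ (by have := two_le_card (K := K); omega)
    rw [Submodule.mem_dualAnnihilator]
    split_ifs with h
    · simp only [true_iff]
      exact fun w hw => h w hw
    · simp only [this.symm, false_iff]
      exact fun h' => h fun w hw => h' hw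
  simp only [h1]
  rw [Submodule.mem_dualAnnihilator]
  exact (Finset.sup_le_iff (f := id) (s := T) (a := LinearMap.ker f)).symm

end FiniteField

/-! ### Consequences of a common residue of the weights. -/

section Residue

variable {K V : Type*} [Field K] [AddCommGroup V] [Module K V]

lemma card_dual [FiniteDimensional K V] [Fintype (Dual K V)] :
    Fintype.card (Dual K V) = Nat.card K ^ finrank K V := by
  rw [← Nat.card_eq_fintype_card, Module.natCard_eq_pow_finrank (K := K), Subspace.dual_finrank_eq]

variable [Finite K]

lemma two_le_pow_finrank [FiniteDimensional K V] {W : Submodule K V} (h : W ≠ ⊥) :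
    2 ≤ Nat.card K ^ finrank K W :=
  two_le_card.trans (Nat.le_self_pow (Nat.one_le_iff_ne_zero.mp (Submodule.one_le_finrank_iff.mpr h)) _)

lemma modEq_cases {a c M : ℕ} (h : a ≡ c [MOD M]) (hc : c < M) : a = c ∨ c + M ≤ a := by
  have h1 : a % M = c := by rw [h, Nat.mod_eq_of_lt hc]
  have h2 := Nat.mod_add_div a M
  rcases Nat.eq_zero_or_pos (a / M) with h3 | h3
  · left; rw [h3] at h2; omega
  · right
    have : M * 1 ≤ M * (a / M) := Nat.mul_le_mul_left _ h3
    omega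

variable [FiniteDimensional K V] {T : Finset (Submodule K V)}

lemma IsPartialSpread.card_mul_two_le (hT : IsPartialSpread T) : T.card * 2 ≤ weight T 0 := by
  rw [weight_zero, ← smul_eq_mul]
  exact card_nsmul_le_sum _ _ _ fun W hW => two_le_pow_finrank (hT.ne_bot W hW)

/-- A common lower bound for the weights is less than the number of members. -/
lemma IsPartialSpread.lt_card_of_le_weight (hT : IsPartialSpread T) (hne : T.Nonempty) {c : ℕ}
    (hc : ∀ f : Dual K V, c ≤ weight T f) : c < T.card := by
  have := Module.finite_of_finite K (M := Dual K V)
  have := Fintype.ofFinite (Dual K V)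
  by_contra! h
  have h0 := hT.card_mul_two_le
  have hpos := hne.card_pos
  -- The mean weight is `T.card`, but `f = 0` alone has weight at least `2 * T.card`.
  have h1 : ∑ _f : Dual K V, T.card < ∑ f : Dual K V, weight T f :=
    sum_lt_sum (fun f _ => h.trans (hc f)) ⟨0, mem_univ _, by omega⟩
  rw [sum_weight, sum_const, smul_eq_mul, card_univ, card_dual] at h1
  exact lt_irrefl _ h1

/-- No weight lies strictly between `c` and `c + M`, so `(w - c)(w - c - M)` is nonnegative;
averaging it with the two moments gives the bound. -/
lemma IsPartialSpread.mul_le_weight_zero (hT : IsPartialSpread T) {c M : ℕ}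
    (hc : ∀ f : Dual K V, weight T f = c ∨ c + M ≤ weight T f) :
    ((T.card : ℤ) - c) * (M - (T.card - c)) + T.card ≤ weight T 0 := by
  have := Module.finite_of_finite K (M := Dual K V)
  have := Fintype.ofFinite (Dual K V)
  have h1 := sum_weight T
  have h2 := hT.sum_weight_mul_self
  have h3 : (0 : ℤ) ≤ ∑ f : Dual K V, ((weight T f : ℤ) - c) * (weight T f - c - M) := by
    refine sum_nonneg fun f _ => ?_
    rcases hc f with h | h
    · simp [h]
    · have : (c : ℤ) + M ≤ weight T f := by exact_mod_cast h
      exact mul_nonneg (by omega) (by omega)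
  have h4 : ∑ f : Dual K V, ((weight T f : ℤ) - c) * (weight T f - c - M) =
      ∑ f : Dual K V, (weight T f : ℤ) * weight T f - (2 * c + M) * ∑ f : Dual K V, (weight T f : ℤ)
        + Nat.card K ^ finrank K V * (c * (c + M)) := by
    have h5 : (Nat.card K ^ finrank K V * (c * (c + M)) : ℤ) =
        ∑ _f : Dual K V, ((c : ℤ) * (c + M)) := by
      rw [sum_const, card_univ, card_dual, nsmul_eq_mul]; push_cast; ring
    rw [h5, mul_sum, ← sum_sub_distrib, ← sum_add_distrib]
    exact sum_congr rfl fun f _ => by ring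
  zify at h1 h2
  rw [h4, h1] at h3
  have hq : (0 : ℤ) < (Nat.card K : ℤ) ^ finrank K V := by
    have := two_le_card (K := K)
    positivity
  have h6 : (0 : ℤ) ≤ (Nat.card K : ℤ) ^ finrank K V *
      (weight T 0 - (((T.card : ℤ) - c) * (M - (T.card - c)) + T.card)) := by
    linarith
  have := nonneg_of_mul_nonneg_right h6 hq
  linarith

/-- If all weights are at least `#T - 1` then the union of `T` is a subspace. -/
lemma IsPartialSpread.card_sup_of_le_weight (hT : IsPartialSpread T) {c : ℕ}
    (hc : ∀ f : Dual K V, c ≤ weight T f) (hx : c + 1 = T.card) :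
    Nat.card K ^ finrank K (T.sup id : Submodule K V) + c = weight T 0 ∧
      ∀ f : Dual K V, f ∉ (T.sup id).dualAnnihilator → weight T f = c := by
  classical
  have := Module.finite_of_finite K (M := Dual K V)
  have := Fintype.ofFinite (Dual K V)
  have h1 := sum_weight T
  have h2 := hT.sum_weight_mul_self
  rw [← hx] at h1 h2
  -- All terms are nonnegative, and for `c = #T - 1` the moments make the sum vanish: only the
  -- weights `c` and `weight T 0` occur.
  have h3 : ∑ f : Dual K V, ((weight T f : ℤ) - c) * (weight T 0 - weight T f) = 0 := by
    have h4 : ∑ f : Dual K V, ((weight T f : ℤ) - c) * (weight T 0 - weight T f) =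
        (weight T 0 + c) * ∑ f : Dual K V, (weight T f : ℤ) -
        ∑ f : Dual K V, (weight T f : ℤ) * weight T f -
        Nat.card K ^ finrank K V * (c * weight T 0) := by
      have h5 : (Nat.card K ^ finrank K V * (c * weight T 0) : ℤ) =
          ∑ _f : Dual K V, ((c : ℤ) * weight T 0) := by
        rw [sum_const, card_univ, card_dual, nsmul_eq_mul]; push_cast; ring
      rw [h5, mul_sum, ← sum_sub_distrib, ← sum_sub_distrib]
      exact sum_congr rfl fun f _ => by ring
    zify at h1 h2
    rw [h4, h1]
    linarith
  have h6 : ∀ f : Dual K V, f ∉ (T.sup id).dualAnnihilator → weight T f = c := by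
    intro f hf
    have h7 := (sum_eq_zero_iff_of_nonneg (fun f _ => mul_nonneg
      (by have := hc f; omega) (by have := weight_le_weight_zero T f; omega))).mp h3 f (mem_univ f)
    rw [← weight_eq_weight_zero_iff] at hf
    rcases mul_eq_zero.mp h7 with h | h <;> omega
  refine ⟨?_, h6⟩
  have hc0 := hc 0
  obtain ⟨e, he⟩ := Nat.exists_eq_add_of_le hc0
  have h8 : ∑ f : Dual K V, weight T f =
      ∑ f : Dual K V, (c + if f ∈ (T.sup id).dualAnnihilator then e else 0) := by
    refine sum_congr rfl fun f _ => ?_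
    split_ifs with hf
    · rw [(weight_eq_weight_zero_iff T f).mpr hf, he]
    · rw [h6 f hf, add_zero]
  rw [sum_add_distrib, sum_ite_dualAnnihilator, sum_const, smul_eq_mul, card_univ, card_dual,
    h1, mul_add, mul_one, Nat.add_left_cancel_iff, ← card_dualAnnihilator_mul (T.sup id)] at h8
  have := Nat.eq_of_mul_eq_mul_left (Nat.card_pos) h8
  rw [he, this, add_comm]

/-- If the common residue is less than the size of a member, then there are many members. -/
lemma IsPartialSpread.lt_card_add (hT : IsPartialSpread T) {c d : ℕ}
    (hc : ∀ f : Dual K V, weight T f = c ∨ c + Nat.card K ^ d ≤ weight T f)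
    {W : Submodule K V} (hW : W ∈ T) (hWd : finrank K W < d) (hcW : c < Nat.card K ^ finrank K W) :
    Nat.card K ^ d + c + 1 < T.card + Nat.card K ^ finrank K W := by
  classical
  have := Module.finite_of_finite K (M := Dual K V)
  have := Fintype.ofFinite (Dual K V)
  have hlt : Nat.card K ^ finrank K W < Nat.card K ^ d := Nat.pow_lt_pow_right two_le_card hWd
  have key := hT.sum_blockWeight_mul_weight hW
  by_contra! h
  -- A functional vanishing on `W` has weight at least `q ^ dim W > c`, hence at least `c + q ^ d`.
  -- The mean weight over these functionals is `#T + q ^ dim W - 1`.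
  have h1 : ∀ f : Dual K V, blockWeight W f * (c + Nat.card K ^ d) ≤
      blockWeight W f * weight T f := by
    intro f
    by_cases hf : f ∈ W.dualAnnihilator
    · refine Nat.mul_le_mul_left _ ?_
      have h2 := blockWeight_le_weight hW f
      rw [blockWeight_of_mem hf] at h2
      rcases hc f with h3 | h3 <;> omega
    · simp [blockWeight, hf]
  -- The first alternative makes the averaged inequality strict at `f = 0`; the second contradicts
  -- even the weak inequality.
  have h2 : c + Nat.card K ^ d < weight T 0 ∨ T.card + Nat.card K ^ finrank K W ≤
      c + Nat.card K ^ d := by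
    by_contra! h'
    have h3 : weight T 0 = ∑ U ∈ T.erase W, Nat.card K ^ finrank K U + Nat.card K ^ finrank K W :=
      by rw [weight_zero, sum_erase_add _ _ hW]
    have h4 : (T.erase W).card * 2 ≤ ∑ U ∈ T.erase W, Nat.card K ^ finrank K U := by
      rw [← smul_eq_mul]
      exact card_nsmul_le_sum _ _ _ fun U hU =>
        two_le_pow_finrank (hT.ne_bot U (mem_of_mem_erase hU))
    have h5 := card_erase_add_one hW
    omega
  have h3 : (∑ f : Dual K V, blockWeight W f) * (c + Nat.card K ^ d) ≤
      ∑ f : Dual K V, blockWeight W f * weight T f := by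
    rw [sum_mul]; exact sum_le_sum fun f _ => h1 f
  have hq : 0 < Nat.card K ^ finrank K V := by have := two_le_card (K := K); positivity
  rcases h2 with h2 | h2
  · have h4 : (∑ f : Dual K V, blockWeight W f) * (c + Nat.card K ^ d) <
        ∑ f : Dual K V, blockWeight W f * weight T f := by
      rw [sum_mul]
      refine sum_lt_sum (fun f _ => h1 f) ⟨0, mem_univ _, ?_⟩
      have : 0 < blockWeight W (0 : Dual K V) := by
        rw [blockWeight_of_mem (zero_mem _)]; have := two_le_card (K := K); positivity
      exact Nat.mul_lt_mul_of_pos_left h2 this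
    rw [sum_blockWeight] at h4
    have h5 : Nat.card K ^ finrank K V * (c + Nat.card K ^ d + 1) <
        Nat.card K ^ finrank K V * (T.card + Nat.card K ^ finrank K W) := by
      rw [← key]; linarith
    have := Nat.lt_of_mul_lt_mul_left h5
    omega
  · rw [sum_blockWeight] at h3
    have h5 : Nat.card K ^ finrank K V * (c + Nat.card K ^ d + 1) ≤
        Nat.card K ^ finrank K V * (T.card + Nat.card K ^ finrank K W) := by
      rw [← key]; linarith
    have := Nat.le_of_mul_le_mul_left h5 hq
    omega

end Residue

/-! ### Arithmetic of the extremal size. -/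

/-- The closed formula for the least size of a subspace partition of an `n`-dimensional space over
the field with `q` elements whose largest member has dimension `t`. -/
def extremalSize (q n t : ℕ) : ℕ :=
  if n < 2 * t then q ^ t + 1
  else q ^ (t + n % t) * ∑ i ∈ range (n / t - 1), (q ^ t) ^ i +
    (if n % t = 0 then 0 else q ^ ((t + n % t + 1) / 2)) + 1

lemma extremalSize_of_lt {q n t : ℕ} (h : n < 2 * t) : extremalSize q n t = q ^ t + 1 := if_pos h

/-- With `r = n % t`, the number `A = (q^n - q^(t+r)) / (q^t - 1)` counts the `t`-dimensional
members needed outside one subspace of dimension `t + r`; the relation is stated without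
subtraction. -/
lemma exists_extremalSize_eq {q n t : ℕ} (hq : 2 ≤ q) (ht : 1 ≤ t) (h : 2 * t ≤ n) :
    ∃ A, extremalSize q n t = A + (if n % t = 0 then 0 else q ^ ((t + n % t + 1) / 2)) + 1 ∧
      A * q ^ t + q ^ (t + n % t) = q ^ n + A ∧ q ^ (t + n % t) ∣ A := by
  refine ⟨q ^ (t + n % t) * ∑ i ∈ range (n / t - 1), (q ^ t) ^ i, if_neg (by omega), ?_,
    Dvd.intro _ rfl⟩
  have h1 : 2 ≤ n / t := (Nat.le_div_iff_mul_le ht).mpr h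
  have h2 : n = (t + n % t) + t * (n / t - 1) := by
    have := Nat.mod_add_div n t
    obtain ⟨k, hk⟩ := Nat.exists_eq_add_of_le h1
    rw [hk, show 2 + k - 1 = k + 1 by omega]
    rw [hk] at this
    linarith
  have h4 : (∑ i ∈ range (n / t - 1), (q ^ t) ^ i) * q ^ t + 1 =
      (q ^ t) ^ (n / t - 1) + ∑ i ∈ range (n / t - 1), (q ^ t) ^ i := by
    have := geom_sum_mul_add (q ^ t - 1) (n / t - 1)
    rw [Nat.sub_add_cancel (Nat.one_le_pow _ _ (by omega))] at this
    rw [← this, Nat.mul_sub_one]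
    have : ∑ i ∈ range (n / t - 1), (q ^ t) ^ i ≤
        (∑ i ∈ range (n / t - 1), (q ^ t) ^ i) * q ^ t :=
      Nat.le_mul_of_pos_right _ (by positivity)
    omega
  have h5 : q ^ n = q ^ (t + n % t) * (q ^ t) ^ (n / t - 1) := by
    rw [← pow_mul, ← pow_add, ← h2]
  rw [h5]
  calc _ = q ^ (t + n % t) * ((∑ i ∈ range (n / t - 1), (q ^ t) ^ i) * q ^ t + 1) := by ring
    _ = _ := by rw [h4]; ring

/-- These are exactly the smallness conditions under which `IsPartialSpread.residue_add_one_eq`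
determines the residue. -/
lemma extremalSize_bounds {q n t : ℕ} (hq : 2 ≤ q) (ht : 1 ≤ t) (h : 2 * t ≤ n) :
    extremalSize q n t < q ^ n ∧
      extremalSize q n t * q ^ t + 4 < 2 * q ^ n + extremalSize q n t := by
  obtain ⟨A, hf, hA, -⟩ := exists_extremalSize_eq hq ht h
  have hqt : 2 ≤ q ^ t := hq.trans (Nat.le_self_pow (by omega) _)
  have hn : q ^ (2 * t) ≤ q ^ n := Nat.pow_le_pow_right (by omega) h
  have hn2 : q ^ (2 * t) = q ^ t * q ^ t := by rw [two_mul, pow_add]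
  rw [hf]
  split_ifs with hr
  · rw [hr, add_zero] at hA
    constructor
    · nlinarith
    · nlinarith
  · have hrt : n % t < t := Nat.mod_lt _ ht
    have ht2 : 4 ≤ q ^ t := by
      calc 4 = 2 ^ 2 := rfl
        _ ≤ q ^ 2 := Nat.pow_le_pow_left hq 2
        _ ≤ q ^ t := Nat.pow_le_pow_right (by omega) (by omega)
    have h1 : q ^ t * 2 ≤ q ^ (t + n % t) := by
      rw [pow_add]
      exact Nat.mul_le_mul_left _ (hq.trans (Nat.le_self_pow hr _))
    have h2 : q ^ ((t + n % t + 1) / 2) * q ^ t ≤ q ^ n := by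
      rw [← pow_add]; exact Nat.pow_le_pow_right (by omega) (by omega)
    have h3 : 0 < q ^ ((t + n % t + 1) / 2) := by positivity
    have h4 : (A + q ^ ((t + n % t + 1) / 2) + 1) * q ^ t + 4 <
        2 * q ^ n + (A + q ^ ((t + n % t + 1) / 2) + 1) := by
      nlinarith
    exact ⟨by nlinarith, h4⟩

/-! ### Lower bounds for divisible partial spreads. -/

section Bound

variable {K V : Type*} [Field K] [AddCommGroup V] [Module K V] {T : Finset (Submodule K V)}

lemma mem_supertail {k : ℕ} {W : Submodule K V} :
    W ∈ supertail T k ↔ W ∈ T ∧ finrank K W < k := by simp [supertail]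

lemma supertail_subset (T : Finset (Submodule K V)) (k : ℕ) : supertail T k ⊆ T :=
  filter_subset _ _

lemma sum_supertail_add (T : Finset (Submodule K V)) (k : ℕ) (g : Submodule K V → ℕ) :
    ∑ W ∈ supertail T k, g W + ∑ W ∈ T.filter (fun W : Submodule K V => ¬ finrank K W < k), g W = ∑ W ∈ T, g W :=
  sum_filter_add_sum_filter_not _ _ _

/-- A discarded member has dimension at least `k` and contributes a multiple of `q ^ k`. -/
lemma weight_supertail_modEq (T : Finset (Submodule K V)) (k : ℕ) (f : Dual K V) :
    weight (supertail T k) f ≡ weight T f [MOD Nat.card K ^ k] := by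
  have h1 : Nat.card K ^ k ∣ ∑ W ∈ T.filter (fun W : Submodule K V => ¬ finrank K W < k), blockWeight W f := by
    refine dvd_sum fun W hW => ?_
    rw [mem_filter, not_lt] at hW
    unfold blockWeight
    split_ifs
    · exact pow_dvd_pow _ hW.2
    · exact dvd_zero _
  rw [weight, weight, ← sum_supertail_add T k]
  have := (Nat.modEq_zero_iff_dvd.mpr h1).symm.add_left
    (∑ W ∈ supertail T k, blockWeight W f)
  simpa using this

lemma IsDivisible.supertail {d k : ℕ} (h : IsDivisible T d) (hk : k ≤ d) :
    IsDivisible (supertail T k) k := fun f =>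
  ((weight_supertail_modEq T k f).trans ((h f).of_dvd (pow_dvd_pow _ hk))).trans
    (weight_supertail_modEq T k 0).symm

lemma IsDivisible.exists_residue [Finite K] {d : ℕ} (h : IsDivisible T d) :
    ∃ c < Nat.card K ^ d, ∀ f : Dual K V, weight T f ≡ c [MOD Nat.card K ^ d] :=
  ⟨weight T 0 % Nat.card K ^ d, Nat.mod_lt _ (pow_pos Nat.card_pos _),
    fun f => (h f).trans (Nat.mod_modEq _ _).symm⟩

lemma weight_zero_le {t : ℕ} [Finite K] (hmax : ∀ W ∈ T, finrank K W ≤ t) :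
    weight T 0 ≤ T.card * Nat.card K ^ t := by
  rw [weight_zero, ← smul_eq_mul]
  exact sum_le_card_nsmul _ _ _ fun W hW => Nat.pow_le_pow_right Nat.card_pos (hmax W hW)

variable [Finite K] [FiniteDimensional K V]

/-- A divisible partial spread has more members than one of its members has elements. -/
lemma IsPartialSpread.pow_finrank_lt_card (hT : IsPartialSpread T) {c d : ℕ}
    (hcd : c < Nat.card K ^ d) (hc : ∀ f : Dual K V, weight T f ≡ c [MOD Nat.card K ^ d])
    {W : Submodule K V} (hW : W ∈ T) (hWd : finrank K W < d) :
    Nat.card K ^ finrank K W < T.card ∧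
      (T.card = Nat.card K ^ finrank K W + 1 → c = Nat.card K ^ finrank K W) := by
  have hcases := fun f => modEq_cases (hc f) hcd
  have h1 : c < T.card := hT.lt_card_of_le_weight ⟨W, hW⟩ fun f => by
    rcases hcases f with h | h <;> omega
  have h2 : Nat.card K ^ finrank K W * 2 ≤ Nat.card K ^ d :=
    calc _ ≤ Nat.card K ^ finrank K W * Nat.card K := Nat.mul_le_mul_left _ two_le_card
      _ = Nat.card K ^ (finrank K W + 1) := (pow_succ _ _).symm
      _ ≤ _ := Nat.pow_le_pow_right Nat.card_pos hWd
  rcases lt_or_ge c (Nat.card K ^ finrank K W) with h | h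
  · have := hT.lt_card_add hcases hW hWd h
    omega
  · omega

/-- The quadratic bound is concave in `#T - c`, so away from `#T - c = 1` it is smallest at the ends
of the range, where it already exceeds the total weight allowed by dimension at most `t`. -/
lemma IsPartialSpread.residue_add_one_eq (hT : IsPartialSpread T) {c d t : ℕ}
    (hcd : c < Nat.card K ^ d) (hc : ∀ f : Dual K V, weight T f ≡ c [MOD Nat.card K ^ d])
    (hmax : ∀ W ∈ T, finrank K W ≤ t) {W : Submodule K V} (hW : W ∈ T) (hWt : finrank K W = t)
    (htd : t < d) (h1 : T.card < Nat.card K ^ d)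
    (h2 : T.card * Nat.card K ^ t + 4 < 2 * Nat.card K ^ d + T.card) : c + 1 = T.card := by
  have hcases := fun f => modEq_cases (hc f) hcd
  have h3 : c < T.card := hT.lt_card_of_le_weight ⟨W, hW⟩ fun f => by
    rcases hcases f with h | h <;> omega
  have h4 := hT.mul_le_weight_zero hcases
  have h5 := weight_zero_le hmax
  have hqt : 2 ≤ Nat.card K ^ t := hWt ▸ two_le_pow_finrank (hT.ne_bot W hW)
  obtain ⟨y, hy⟩ := Nat.exists_eq_add_of_lt h3
  by_contra hne
  have hy1 : 1 ≤ y := by omega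
  have h6 : (T.card : ℤ) - c = y + 1 := by rw [hy]; push_cast; ring
  rw [h6] at h4
  by_cases h7 : y + 2 < Nat.card K ^ d
  · have h8 : (T.card : ℤ) * Nat.card K ^ t + 4 < 2 * Nat.card K ^ d + T.card := by
      exact_mod_cast h2
    have h9 : (weight T 0 : ℤ) ≤ T.card * Nat.card K ^ t := by exact_mod_cast h5
    have h10 : ((y : ℤ) + 2) + 1 ≤ Nat.card K ^ d := by exact_mod_cast h7
    push_cast at h4
    -- Concavity: the value at `y` is at least the common value `2 * (q ^ d - 2)` at `y = 1` and `y
    -- = q ^ d - 3`.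
    nlinarith [mul_nonneg (show (0 : ℤ) ≤ y - 1 by omega)
      (show (0 : ℤ) ≤ Nat.card K ^ d - (y + 2) - 1 by omega)]
  -- Only `c = 0` and `#T = q ^ d - 1` remain.
  · have hc0 : c = 0 := by omega
    have := hT.lt_card_add hcases hW (hWt ▸ htd) (by rw [hWt]; omega)
    rw [hWt] at this
    by_cases h8 : Nat.card K ^ t = 2
    · omega
    · have : 3 ≤ Nat.card K ^ t := by omega
      nlinarith

/-- For `#T` at most the extremal size the residue is `#T - 1`, so the total weight is at least `q^d
+ #T - 1`. If `t ∤ d`, reducing the residue modulo a smaller power of `q` forces many small members,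
and these make that total unattainable. -/
lemma IsPartialSpread.extremalSize_le_of_two_mul_le (hT : IsPartialSpread T) {d t : ℕ}
    (hdiv : IsDivisible T d) (hmax : ∀ W ∈ T, finrank K W ≤ t) {W : Submodule K V} (hW : W ∈ T)
    (hWt : finrank K W = t) (htd : 2 * t ≤ d) :
    extremalSize (Nat.card K) d t ≤ T.card ∧
      (T.card = extremalSize (Nat.card K) d t → ∃ c,
        (∀ f : Dual K V, c ≤ weight T f) ∧ c + 1 = T.card ∧
        finrank K (T.sup id : Submodule K V) = d) := by
  obtain ⟨c, hcd, hc⟩ := hdiv.exists_residue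
  have hcases := fun f => modEq_cases (hc f) hcd
  have hle : ∀ f : Dual K V, c ≤ weight T f := fun f => by
    rcases hcases f with h | h <;> omega
  have hq := two_le_card (K := K)
  have ht : 1 ≤ t := hWt ▸ Submodule.one_le_finrank_iff.mpr (hT.ne_bot W hW)
  obtain ⟨hb1, hb2⟩ := extremalSize_bounds hq ht htd
  have hqt : 2 ≤ Nat.card K ^ t := hq.trans (Nat.le_self_pow (by omega) _)
  have hb3 : T.card ≤ extremalSize (Nat.card K) d t →
      T.card * Nat.card K ^ t + 4 < 2 * Nat.card K ^ d + T.card := fun h => by nlinarith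
  have hresidue : T.card ≤ extremalSize (Nat.card K) d t → c + 1 = T.card := fun h =>
    hT.residue_add_one_eq hcd hc hmax hW hWt (by omega) (h.trans_lt hb1) (hb3 h)
  have hlow : T.card ≤ extremalSize (Nat.card K) d t →
      Nat.card K ^ d + T.card ≤ weight T 0 + 1 := by
    intro h
    have h1 := hT.mul_le_weight_zero hcases
    have h2 : (T.card : ℤ) - c = 1 := by rw [← hresidue h]; push_cast; ring
    rw [h2] at h1
    push_cast at h1
    zify
    linarith
  have hup := weight_zero_le hmax
  constructor
  · by_contra! hlt
    have hcx := hresidue hlt.le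
    have hlow := hlow hlt.le
    obtain ⟨A, hf, hA, hdvd⟩ := exists_extremalSize_eq hq ht htd
    rw [hf] at hlt
    -- With at most `A` members of dimension at most `t`, the total weight stays below `q ^ d + #T -
    -- 1`.
    have hAx : A < T.card := by
      by_contra! h
      have : 2 ≤ Nat.card K ^ (t + d % t) := hq.trans (Nat.le_self_pow (by omega) _)
      nlinarith
    split_ifs at hlt with hr
    · omega
    set Z := (t + d % t + 1) / 2 with hZ
    have hrt : d % t < t := Nat.mod_lt _ ht
    obtain ⟨z, hz⟩ := Nat.exists_eq_add_of_lt hAx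
    have hcz : c = A + z := by omega
    -- As `q ^ Z ∣ A`, the residue `A + z` reduces to `z`; if members of dimension below `Z` exist,
    -- there are more than `z` of them.
    have hmod : ∀ f : Dual K V, weight (supertail T Z) f ≡ z [MOD Nat.card K ^ Z] := by
      intro f
      refine (weight_supertail_modEq T Z f).trans
        (((hc f).of_dvd (pow_dvd_pow _ (by omega))).trans ?_)
      rw [hcz]
      have : Nat.card K ^ Z ∣ A := (pow_dvd_pow _ (by omega)).trans hdvd
      simpa using ((Nat.modEq_zero_iff_dvd.mpr this).add_right z)
    have hzZ : z < Nat.card K ^ Z := by omega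
    have hR : Nat.card K ^ Z * Nat.card K ^ (Z - 1) ≤ Nat.card K ^ (t + d % t) := by
      rw [← pow_add]; exact Nat.pow_le_pow_right (by omega) (by omega)
    have hqZ : 2 ≤ Nat.card K ^ Z := hq.trans (Nat.le_self_pow (by omega) _)
    have hp : 1 ≤ Nat.card K ^ (Z - 1) := Nat.one_le_pow _ _ (by omega)
    rcases (supertail T Z).eq_empty_or_nonempty with hemp | hne
    · have hz0 : z = 0 := by
        have := hmod 0
        rw [hemp] at this
        have := modEq_cases this hzZ
        simp [weight] at this
        omega
      have h1 : Nat.card K ^ t * 2 ≤ Nat.card K ^ (t + d % t) := by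
        rw [pow_add]
        exact Nat.mul_le_mul_left _ (hq.trans (Nat.le_self_pow hr _))
      rw [hz, hz0] at hlow hup
      nlinarith
    · have hzx : z < (supertail T Z).card :=
        (hT.mono (supertail_subset T Z)).lt_card_of_le_weight hne fun f => by
          rcases modEq_cases (hmod f) hzZ with h | h <;> omega
      have hS : weight T 0 + (supertail T Z).card * Nat.card K ^ t ≤
          (supertail T Z).card * Nat.card K ^ (Z - 1) + T.card * Nat.card K ^ t := by
        have e1 : (supertail T Z).card + (T.filter fun W : Submodule K V => ¬ finrank K W < Z).card = T.card :=
          card_filter_add_card_filter_not _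
        have e2 : ∑ W ∈ supertail T Z, Nat.card K ^ finrank K W ≤
            (supertail T Z).card * Nat.card K ^ (Z - 1) := by
          rw [← weight_zero]
          exact weight_zero_le fun W hW => by have := (mem_supertail.mp hW).2; omega
        have e3 : ∑ W ∈ T.filter (fun W : Submodule K V => ¬ finrank K W < Z), Nat.card K ^ finrank K W ≤
            (T.filter fun W : Submodule K V => ¬ finrank K W < Z).card * Nat.card K ^ t := by
          rw [← weight_zero]
          exact weight_zero_le fun W hW => hmax W (mem_of_mem_filter W hW)
        rw [weight_zero, ← sum_supertail_add T Z, ← e1]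
        linarith
      have hpt : Nat.card K ^ (Z - 1) ≤ Nat.card K ^ t :=
        Nat.pow_le_pow_right (by omega) (by omega)
      obtain ⟨g, hg⟩ := Nat.exists_eq_add_of_le hpt
      have h1 : (z + 1) * g ≤ (supertail T Z).card * g := Nat.mul_le_mul_right _ hzx
      have h2 : (z + 1) * Nat.card K ^ (Z - 1) ≤ Nat.card K ^ Z * Nat.card K ^ (Z - 1) :=
        Nat.mul_le_mul_right _ hzZ
      have h3 : 2 * Nat.card K ^ (Z - 1) ≤ Nat.card K ^ Z * Nat.card K ^ (Z - 1) :=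
        Nat.mul_le_mul_right _ hqZ
      rw [hg] at hS hA
      rw [hz] at hS hlow
      -- The right side is at most `q ^ (2Z - 1) ≤ q ^ (t + d % t)`, leaving only `z = 0`, where the
      -- inequality fails too.
      have h4 : Nat.card K ^ (t + d % t) + z ≤ (z + 1) * Nat.card K ^ (Z - 1) := by
        nlinarith
      have h5 : z = 0 := by omega
      subst h5
      omega
  · intro heq
    refine ⟨c, hle, hresidue heq.le, ?_⟩
    have hcx := hresidue heq.le
    have hcard := (hT.card_sup_of_le_weight hle hcx).1
    have hlow := hlow heq.le
    have hb3 := hb3 heq.le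
    refine le_antisymm ?_ ?_
    -- The span has `weight T 0 - c` elements, which the size bound keeps below `2 * q ^ d`.
    · by_contra! h
      have h1 : Nat.card K ^ d * 2 ≤ Nat.card K ^ finrank K (T.sup id : Submodule K V) :=
        calc _ ≤ Nat.card K ^ d * Nat.card K := Nat.mul_le_mul_left _ hq
          _ = Nat.card K ^ (d + 1) := (pow_succ _ _).symm
          _ ≤ _ := Nat.pow_le_pow_right (by omega) h
      omega
    · exact (Nat.pow_le_pow_iff_right (by omega)).mp (by omega : Nat.card K ^ d ≤ _)

/-- The lower bound for the size of a divisible partial spread. -/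
lemma IsPartialSpread.extremalSize_le (hT : IsPartialSpread T) {d t : ℕ}
    (hdiv : IsDivisible T d) (hmax : ∀ W ∈ T, finrank K W ≤ t) {W : Submodule K V} (hW : W ∈ T)
    (hWt : finrank K W = t) (htd : t < d) : extremalSize (Nat.card K) d t ≤ T.card := by
  rcases lt_or_ge d (2 * t) with h | h
  · rw [extremalSize_of_lt h]
    obtain ⟨c, hcd, hc⟩ := hdiv.exists_residue
    exact hWt ▸ (hT.pow_finrank_lt_card hcd hc hW (by omega)).1
  · exact (hT.extremalSize_le_of_two_mul_le hdiv hmax hW hWt h).1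

end Bound

/-! ### Counting vectors: partitions have congruent weights. -/

section Nonzeros

variable {K V : Type*} [Field K] [AddCommGroup V] [Module K V]

lemma IsSubspacePartition.isPartialSpread {P : Finset (Submodule K V)}
    (hP : IsSubspacePartition P) : IsPartialSpread P := by
  refine ⟨hP.ne_bot, fun W hW U hU hne => Submodule.disjoint_def.mpr fun v hv hv' => ?_⟩
  by_contra h0
  exact hne ((hP.existsUnique_mem v h0).unique ⟨hW, hv⟩ ⟨hU, hv'⟩)

lemma IsPartialSpread.eq_of_mem {T : Finset (Submodule K V)} (hT : IsPartialSpread T)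
    {W U : Submodule K V} (hW : W ∈ T) (hU : U ∈ T) {v : V} (hv : v ≠ 0) (hvW : v ∈ W)
    (hvU : v ∈ U) : W = U := by
  by_contra hne
  exact hv (Submodule.disjoint_def.mp (hT.disjoint W hW U hU hne) v hvW hvU)

open Classical in
/-- The nonzero elements of a subspace. -/
noncomputable def nonzeros [Fintype V] (H : Submodule K V) : Finset V :=
  univ.filter fun v => v ∈ H ∧ v ≠ 0

lemma mem_nonzeros [Fintype V] {H : Submodule K V} {v : V} :
    v ∈ nonzeros H ↔ v ∈ H ∧ v ≠ 0 := by simp [nonzeros]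

lemma pow_finrank_inf_top (W : Submodule K V) :
    Nat.card K ^ finrank K (W ⊓ ⊤ : Submodule K V) = Nat.card K ^ finrank K W := by
  rw [inf_top_eq]

variable [FiniteDimensional K V]

lemma card_nonzeros_add_one [Fintype V] (H : Submodule K V) :
    (nonzeros H).card + 1 = Nat.card K ^ finrank K H := by
  classical
  have h : nonzeros H = (univ.filter fun v => v ∈ H).erase 0 := by
    ext v
    simp [nonzeros, and_comm]
  rw [h, card_erase_add_one (by simp), ← Module.natCard_eq_pow_finrank, Nat.card_eq_fintype_card,
    Fintype.card_subtype]

lemma IsPartialSpread.card_biUnion_nonzeros [Fintype V] [DecidableEq V]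
    {T : Finset (Submodule K V)} (hT : IsPartialSpread T) (H : Submodule K V) :
    (T.biUnion fun W => nonzeros (W ⊓ H)).card + T.card =
      ∑ W ∈ T, Nat.card K ^ finrank K (W ⊓ H : Submodule K V) := by
  rw [card_biUnion]
  · rw [card_eq_sum_ones T, ← sum_add_distrib]
    exact sum_congr rfl fun W _ => card_nonzeros_add_one _
  · intro W hW U hU hne
    refine Finset.disjoint_left.mpr fun v hv hv' => hne ?_
    rw [mem_nonzeros] at hv hv'
    exact hT.eq_of_mem hW hU hv.2 hv.1.1 hv'.1.1

/-- A partial spread covers its span if it has sufficiently many elements. -/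
lemma IsPartialSpread.exists_mem_of_mem_sup [Finite K] {T : Finset (Submodule K V)}
    (hT : IsPartialSpread T)
    (h : Nat.card K ^ finrank K (T.sup id : Submodule K V) + T.card = weight T 0 + 1)
    {v : V} (hv : v ∈ T.sup id) (hv0 : v ≠ 0) : ∃ W ∈ T, v ∈ W := by
  classical
  have := Module.finite_of_finite K (M := V)
  have := Fintype.ofFinite V
  have h1 := hT.card_biUnion_nonzeros ⊤
  simp only [inf_top_eq] at h1
  rw [sum_congr rfl fun W _ => pow_finrank_inf_top W] at h1
  have h2 := card_nonzeros_add_one (K := K) (V := V) (T.sup id)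
  rw [weight_zero] at h
  have h3 : T.biUnion nonzeros ⊆ nonzeros (T.sup id) := by
    intro u hu
    obtain ⟨W, hW, hu⟩ := mem_biUnion.mp hu
    rw [mem_nonzeros] at hu ⊢
    exact ⟨(le_sup (f := id) hW : W ≤ T.sup id) hu.1, hu.2⟩
  have h4 := eq_of_subset_of_card_le h3 (by
    have : (T.biUnion fun W => nonzeros W) = T.biUnion nonzeros := rfl
    rw [this] at h1
    omega)
  have h5 : v ∈ nonzeros (T.sup id) := mem_nonzeros.mpr ⟨hv, hv0⟩
  rw [← h4] at h5
  obtain ⟨W, hW, h6⟩ := mem_biUnion.mp h5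
  exact ⟨W, hW, (mem_nonzeros.mp h6).1⟩

/-- Either `W` lies in `ker f`, or it meets `ker f` in a hyperplane of `W`; this treats both cases
in one identity that can be summed over a partition. -/
lemma mul_pow_finrank_inf_ker_add (W : Submodule K V) (f : Dual K V) :
    Nat.card K * Nat.card K ^ finrank K (W ⊓ LinearMap.ker f : Submodule K V) + blockWeight W f =
      Nat.card K ^ finrank K W + Nat.card K * blockWeight W f := by
  have hmem : f ∈ W.dualAnnihilator ↔ W ≤ LinearMap.ker f := by
    rw [Submodule.mem_dualAnnihilator]; exact Iff.rfl
  by_cases h : W ≤ LinearMap.ker f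
  · rw [blockWeight_of_mem (hmem.mpr h), inf_eq_left.mpr h, add_comm]
  · have h0 : blockWeight W f = 0 := if_neg fun h' => h (hmem.mp h')
    have hf : f ≠ 0 := by rintro rfl; simp at h
    have h1 := Dual.finrank_ker_add_one_of_ne_zero hf
    have h2 := Submodule.finrank_sup_add_finrank_inf_eq W (LinearMap.ker f)
    have h3 : finrank K (LinearMap.ker f) < finrank K (W ⊔ LinearMap.ker f : Submodule K V) :=
      Submodule.finrank_lt_finrank_of_lt
        (lt_of_le_of_ne le_sup_right fun h' => h (h' ▸ le_sup_left))
    have h4 := Submodule.finrank_le (W ⊔ LinearMap.ker f)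
    rw [h0, mul_zero, add_zero, add_zero, ← pow_succ']
    congr 1
    omega

/-- The weights of a subspace partition. -/
lemma IsSubspacePartition.weight_add_one [Finite K] {P : Finset (Submodule K V)}
    (hP : IsSubspacePartition P) (f : Dual K V) :
    weight P f + 1 = blockWeight (⊤ : Submodule K V) f + P.card := by
  classical
  have := Module.finite_of_finite K (M := V)
  have := Fintype.ofFinite V
  have hcover : ∀ H : Submodule K V, (P.biUnion fun W => nonzeros (W ⊓ H)) = nonzeros H := by
    intro H
    ext v
    rw [mem_biUnion, mem_nonzeros]
    constructor
    · rintro ⟨W, -, hv⟩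
      rw [mem_nonzeros] at hv
      exact ⟨hv.1.2, hv.2⟩
    · rintro ⟨hv, hv0⟩
      obtain ⟨W, hW, -⟩ := hP.existsUnique_mem v hv0
      exact ⟨W, hW.1, mem_nonzeros.mpr ⟨⟨hW.2, hv⟩, hv0⟩⟩
  have h1 := hP.isPartialSpread.card_biUnion_nonzeros (LinearMap.ker f)
  have h2 := hP.isPartialSpread.card_biUnion_nonzeros ⊤
  rw [hcover] at h1 h2
  have h3 := card_nonzeros_add_one (K := K) (LinearMap.ker f)
  have h4 := card_nonzeros_add_one (K := K) (V := V) ⊤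
  have h5 := mul_pow_finrank_inf_ker_add ⊤ f
  rw [top_inf_eq] at h5
  have h6 : ∑ W ∈ P, (Nat.card K * Nat.card K ^ finrank K (W ⊓ LinearMap.ker f : Submodule K V) +
      blockWeight W f) = ∑ W ∈ P, (Nat.card K ^ finrank K W + Nat.card K * blockWeight W f) :=
    sum_congr rfl fun W _ => mul_pow_finrank_inf_ker_add W f
  rw [sum_add_distrib, sum_add_distrib, ← mul_sum, ← mul_sum, ← h1] at h6
  rw [sum_congr rfl fun W _ => pow_finrank_inf_top W] at h2
  rw [← h2] at h6
  change _ + weight P f = _ + Nat.card K * weight P f at h6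
  rw [← h3, ← h4] at h5
  obtain ⟨p, hp⟩ := Nat.exists_eq_add_of_le (two_le_card (K := K))
  rw [hp] at h5 h6
  -- Here `p + 1 = q - 1`, the factor left after eliminating the point counts of `V` and `ker f`.
  have h7 : (p + 1) * (weight P f + 1) = (p + 1) * (blockWeight (⊤ : Submodule K V) f + P.card) := by
    linarith
  exact Nat.eq_of_mul_eq_mul_left (Nat.succ_pos p) h7

lemma IsSubspacePartition.isDivisible_supertail [Finite K] {P : Finset (Submodule K V)}
    (hP : IsSubspacePartition P) {d : ℕ} (hd : d ≤ finrank K V) :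
    IsDivisible (supertail P d) d := by
  have h1 : ∀ f : Dual K V, weight P f + 1 ≡ P.card [MOD Nat.card K ^ d] := by
    intro f
    rw [hP.weight_add_one f]
    have : Nat.card K ^ d ∣ blockWeight (⊤ : Submodule K V) f := by
      unfold blockWeight
      split_ifs
      · rw [finrank_top]; exact pow_dvd_pow _ hd
      · exact dvd_zero _
    simpa using (Nat.modEq_zero_iff_dvd.mpr this).add_right P.card
  have h2 : IsDivisible P d := fun f => Nat.ModEq.add_right_cancel' 1 ((h1 f).trans (h1 0).symm)
  exact h2.supertail le_rfl

end Nonzeros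

/-! ### Partitions attaining the extremal size. -/

section Construction

variable {K V : Type*} [Field K] [AddCommGroup V] [Module K V]

/-- `T` consists of nonzero subspaces of `U` that partition the nonzero vectors of `U`. -/
structure IsPartitionOf (T : Finset (Submodule K V)) (U : Submodule K V) : Prop extends
    IsPartialSpread T where
  le : ∀ W ∈ T, W ≤ U
  exists_mem : ∀ v ∈ U, v ≠ 0 → ∃ W ∈ T, v ∈ W

lemma isPartitionOf_singleton {U : Submodule K V} (hU : U ≠ ⊥) : IsPartitionOf {U} U where
  ne_bot := by simpa using hU
  disjoint := by simp
  le := by simp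
  exists_mem v hv _ := ⟨U, by simp, hv⟩

lemma IsPartitionOf.isSubspacePartition {T : Finset (Submodule K V)} (hT : IsPartitionOf T ⊤) :
    IsSubspacePartition T where
  ne_bot := hT.ne_bot
  existsUnique_mem v hv := by
    obtain ⟨W, hW, hvW⟩ := hT.exists_mem v trivial hv
    exact ⟨W, ⟨hW, hvW⟩, fun U hU => hT.toIsPartialSpread.eq_of_mem hU.1 hW hv hU.2 hvW⟩

/-- Refining one member of a partition. -/
lemma IsPartitionOf.refine [DecidableEq (Submodule K V)] {T R : Finset (Submodule K V)}
    {U B : Submodule K V} (hT : IsPartitionOf T U) (hB : B ∈ T) (hR : IsPartitionOf R B) :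
    IsPartitionOf (T.erase B ∪ R) U ∧ (T.erase B ∪ R).card + 1 = T.card + R.card := by
  have hdisj : ∀ W ∈ T.erase B, ∀ W' ∈ R, Disjoint W W' := fun W hW W' hW' =>
    (hT.disjoint W (mem_of_mem_erase hW) B hB (ne_of_mem_erase hW)).mono_right (hR.le W' hW')
  refine ⟨⟨⟨?_, ?_⟩, ?_, ?_⟩, ?_⟩
  · intro W hW
    rcases mem_union.mp hW with h | h
    · exact hT.ne_bot W (mem_of_mem_erase h)
    · exact hR.ne_bot W h
  · intro W hW W' hW' hne
    rcases mem_union.mp hW with h | h <;> rcases mem_union.mp hW' with h' | h'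
    · exact hT.disjoint W (mem_of_mem_erase h) W' (mem_of_mem_erase h') hne
    · exact hdisj W h W' h'
    · exact (hdisj W' h' W h).symm
    · exact hR.disjoint W h W' h' hne
  · intro W hW
    rcases mem_union.mp hW with h | h
    · exact hT.le W (mem_of_mem_erase h)
    · exact (hR.le W h).trans (hT.le B hB)
  · intro v hv hv0
    obtain ⟨W, hW, hvW⟩ := hT.exists_mem v hv hv0
    by_cases h : W = B
    · obtain ⟨W', hW', hvW'⟩ := hR.exists_mem v (h ▸ hvW) hv0
      exact ⟨W', mem_union_right _ hW', hvW'⟩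
    · exact ⟨W, mem_union_left _ (mem_erase.mpr ⟨h, hW⟩), hvW⟩
  · rw [card_union_of_disjoint, ← card_erase_add_one hB]
    · ring
    · refine Finset.disjoint_left.mpr fun W hW hW' => hR.ne_bot W hW' ?_
      exact disjoint_self.mp (hdisj W hW W hW')

variable [Finite K]

/-- A space of dimension `a + b` with `a ≤ b` is partitioned by a subspace of dimension `b` and
`q ^ b` subspaces of dimension `a`. -/
lemma exists_isPartitionOf_add [FiniteDimensional K V] {a b : ℕ} (ha : 1 ≤ a) (hab : a ≤ b) {U : Submodule K V}
    (hU : finrank K U = a + b) :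
    ∃ T : Finset (Submodule K V), IsPartitionOf T U ∧ T.card = Nat.card K ^ b + 1 ∧
      ∃ B ∈ T, finrank K B = b ∧ ∀ W ∈ T, W ≠ B → finrank K W = a := by
  classical
  obtain ⟨p, hp⟩ := CharP.exists K
  have hpp : Fact p.Prime := ⟨CharP.char_is_prime K p⟩
  have : NeZero b := ⟨by omega⟩
  let E := FiniteField.Extension K p b
  have hE : finrank K E = b := FiniteField.finrank_extension K p b
  have : Fintype E := Fintype.ofFinite E
  have hEc : Fintype.card E = Nat.card K ^ b := by
    rw [← Nat.card_eq_fintype_card, FiniteField.natCard_extension]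
  obtain ⟨i, hi⟩ : ∃ i : (Fin a → K) →ₗ[K] E, Function.Injective i := by
    rw [← lift_rank_le_iff_exists_linearMap, ← finrank_eq_rank, ← finrank_eq_rank, hE]
    simpa using hab
  obtain ⟨e⟩ : Nonempty (((Fin a → K) × E) ≃ₗ[K] U) := by
    refine ⟨LinearEquiv.ofFinrankEq _ _ ?_⟩
    rw [hU, finrank_prod, hE, finrank_fin_fun]
  let ψ : ((Fin a → K) × E) →ₗ[K] V := U.subtype ∘ₗ e.toLinearMap
  have hψ : Function.Injective ψ := U.injective_subtype.comp e.injective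
  have hψU : ∀ x, ψ x ∈ U := fun x => (e x).2
  -- Inside `K ^ a × E`, with `E` the extension of degree `b`, take the graphs of `x ↦ c * i x`
  -- together with `0 × E`. Since `E` is a field, `(x, y)` with `x ≠ 0` lies on the graph of `c = y
  -- / i x` and no other.
  let φ : E → (Fin a → K) →ₗ[K] V := fun c =>
    ψ ∘ₗ LinearMap.prod LinearMap.id (LinearMap.mulLeft K c ∘ₗ i)
  have hφ : ∀ c x, φ c x = ψ (x, c * i x) := fun c x => rfl
  have hφinj : ∀ c, Function.Injective (φ c) := by
    intro c x y h
    rw [hφ, hφ] at h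
    exact congrArg Prod.fst (hψ h)
  let β : E →ₗ[K] V := ψ ∘ₗ LinearMap.inr K _ _
  have hβ : ∀ y, β y = ψ (0, y) := fun y => rfl
  have hβinj : Function.Injective β := by
    intro x y h
    rw [hβ, hβ] at h
    exact congrArg Prod.snd (hψ h)
  have hrφ : ∀ c, finrank K (LinearMap.range (φ c)) = a := fun c => by
    rw [LinearMap.finrank_range_of_inj (hφinj c), finrank_fin_fun]
  have hrβ : finrank K (LinearMap.range β) = b := by
    rw [LinearMap.finrank_range_of_inj hβinj, hE]
  have hne : ∀ {W : Submodule K V} {k : ℕ}, 1 ≤ k → finrank K W = k → W ≠ ⊥ := by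
    rintro W k hk h rfl
    rw [finrank_bot] at h
    omega
  have hd1 : ∀ c c', c ≠ c' → Disjoint (LinearMap.range (φ c)) (LinearMap.range (φ c')) := by
    intro c c' hcc
    rw [Submodule.disjoint_def]
    rintro _ ⟨x, rfl⟩ ⟨y, hy⟩
    rw [hφ, hφ] at hy
    have h := hψ hy
    rw [Prod.mk.injEq] at h
    obtain ⟨rfl, h⟩ := h
    have h0 : i y = 0 := by
      by_contra h0
      exact hcc (mul_right_cancel₀ h0 h).symm
    rw [hi (h0.trans (map_zero i).symm), map_zero]
  have hd2 : ∀ c, Disjoint (LinearMap.range (φ c)) (LinearMap.range β) := by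
    intro c
    rw [Submodule.disjoint_def]
    rintro _ ⟨x, rfl⟩ ⟨y, hy⟩
    rw [hφ, hβ] at hy
    have h := congrArg Prod.fst (hψ hy)
    rw [← (show (0 : Fin a → K) = x from h), map_zero]
  have hinj : Function.Injective fun c => LinearMap.range (φ c) := by
    intro c c' h
    by_contra hcc
    have h1 := hd1 c c' hcc
    rw [← (show LinearMap.range (φ c) = LinearMap.range (φ c') from h), disjoint_self] at h1
    exact hne ha (hrφ c) h1
  refine ⟨insert (LinearMap.range β) (univ.image fun c => LinearMap.range (φ c)),
    ⟨⟨?_, ?_⟩, ?_, ?_⟩, ?_, LinearMap.range β, mem_insert_self _ _, hrβ, ?_⟩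
  · intro W hW
    simp only [mem_insert, mem_image, mem_univ, true_and] at hW
    rcases hW with rfl | ⟨c, rfl⟩
    · exact hne (ha.trans hab) hrβ
    · exact hne ha (hrφ c)
  · intro W hW W' hW' hWW
    simp only [mem_insert, mem_image, mem_univ, true_and] at hW hW'
    rcases hW with rfl | ⟨c, rfl⟩ <;> rcases hW' with rfl | ⟨c', rfl⟩
    · exact absurd rfl hWW
    · exact (hd2 c').symm
    · exact hd2 c
    · exact hd1 c c' fun h => hWW (by rw [h])
  · intro W hW
    simp only [mem_insert, mem_image, mem_univ, true_and] at hW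
    rcases hW with rfl | ⟨c, rfl⟩
    · rintro _ ⟨y, rfl⟩
      exact hψU _
    · rintro _ ⟨y, rfl⟩
      exact hψU _
  · intro v hv hv0
    obtain ⟨⟨x, y⟩, hxy⟩ := e.surjective ⟨v, hv⟩
    have hv' : ψ (x, y) = v := congrArg Subtype.val hxy
    by_cases hx : x = 0
    · exact ⟨_, mem_insert_self _ _, ⟨y, by rw [hβ, ← hv', hx]⟩⟩
    · refine ⟨LinearMap.range (φ (y / i x)), mem_insert_of_mem (mem_image_of_mem _ (mem_univ _)),
        ⟨x, ?_⟩⟩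
      have : i x ≠ 0 := fun h => hx (hi (h.trans (map_zero i).symm))
      rw [hφ, div_mul_cancel₀ _ this, hv']
  · rw [card_insert_of_notMem, card_image_of_injective _ hinj, card_univ, hEc]
    simp only [mem_image, mem_univ, true_and, not_exists]
    intro c hc
    have := hd2 c
    rw [hc, disjoint_self] at this
    exact hne (ha.trans hab) hrβ this
  · intro W hW hWB
    simp only [mem_insert, mem_image, mem_univ, true_and] at hW
    rcases hW with rfl | ⟨c, rfl⟩
    · exact absurd rfl hWB
    · exact hrφ c

lemma exists_isPartitionOf_add_mul [FiniteDimensional K V] {t r : ℕ} (ht : 1 ≤ t) (k : ℕ) {U : Submodule K V}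
    (hU : finrank K U = t + r + t * k) :
    ∃ T : Finset (Submodule K V), IsPartitionOf T U ∧
      T.card = Nat.card K ^ (t + r) * ∑ i ∈ range k, (Nat.card K ^ t) ^ i + 1 ∧
      ∃ B ∈ T, finrank K B = t + r ∧ ∀ W ∈ T, W ≠ B → finrank K W = t := by
  classical
  induction k generalizing U with
  | zero =>
    refine ⟨{U}, isPartitionOf_singleton ?_, by simp, U, by simp, by simpa using hU, by simp⟩
    rintro rfl
    rw [finrank_bot] at hU
    omega
  | succ k ih =>
    obtain ⟨T, hT, hTc, B, hB, hBd, hTd⟩ :=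
      exists_isPartitionOf_add (U := U) (a := t) (b := t + r + t * k) ht (by omega)
        (by rw [hU]; ring)
    obtain ⟨R, hR, hRc, B', hB', hBd', hRd⟩ := ih hBd
    obtain ⟨h1, h2⟩ := hT.refine hB hR
    refine ⟨_, h1, ?_, B', mem_union_right _ hB', hBd', ?_⟩
    · rw [sum_range_succ, mul_add, ← pow_mul, ← pow_add]
      omega
    · intro W hW hne
      rcases mem_union.mp hW with h | h
      · exact hTd W (mem_of_mem_erase h) (ne_of_mem_erase h)
      · exact hRd W h hne

/-- For `n ≥ 2t`, split off `t`-dimensional members until one of dimension `t + n % t` is left; if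
that exceeds `t`, cut it into halves as equal as possible, of dimension at most `t`. -/
lemma exists_isPartitionOf_extremalSize [FiniteDimensional K V] {n t : ℕ} (ht : 1 ≤ t)
    (htn : t < n) {U : Submodule K V} (hU : finrank K U = n) :
    ∃ T : Finset (Submodule K V), IsPartitionOf T U ∧
      T.card = extremalSize (Nat.card K) n t ∧ (∃ W ∈ T, finrank K W = t) ∧
      ∀ W ∈ T, finrank K W ≤ t := by
  classical
  rcases lt_or_ge n (2 * t) with h | h
  · obtain ⟨T, hT, hTc, B, hB, hBd, hTd⟩ :=
      exists_isPartitionOf_add (U := U) (a := n - t) (b := t) (by omega) (by omega) (by omega)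
    refine ⟨T, hT, by rw [hTc, extremalSize_of_lt h], ⟨B, hB, hBd⟩, fun W hW => ?_⟩
    by_cases hWB : W = B
    · rw [hWB, hBd]
    · rw [hTd W hW hWB]; omega
  · have h1 : 2 ≤ n / t := (Nat.le_div_iff_mul_le ht).mpr h
    have h2 : n = (t + n % t) + t * (n / t - 1) := by
      have := Nat.mod_add_div n t
      obtain ⟨k, hk⟩ := Nat.exists_eq_add_of_le h1
      rw [hk, show 2 + k - 1 = k + 1 by omega]
      rw [hk] at this
      linarith
    obtain ⟨T, hT, hTc, B, hB, hBd, hTd⟩ :=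
      exists_isPartitionOf_add_mul (U := U) (r := n % t) ht (n / t - 1) (by omega)
    have hrt : n % t < t := Nat.mod_lt _ ht
    unfold extremalSize
    rw [if_neg (by omega)]
    by_cases hr : n % t = 0
    · rw [if_pos hr, add_zero]
      rw [hr, add_zero] at hBd
      refine ⟨T, hT, hTc, ⟨B, hB, hBd⟩, fun W hW => ?_⟩
      by_cases hWB : W = B
      · rw [hWB, hBd]
      · exact (hTd W hW hWB).le
    · rw [if_neg hr]
      obtain ⟨R, hR, hRc, B', hB', hBd', hRd⟩ :=
        exists_isPartitionOf_add (U := B) (a := (t + n % t) / 2) (b := (t + n % t + 1) / 2)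
          (by omega) (by omega) (by omega)
      obtain ⟨h3, h4⟩ := hT.refine hB hR
      refine ⟨_, h3, by omega, ?_, fun W hW => ?_⟩
      · have hT2 : 1 < T.card := by
          rw [hTc]
          have : 0 < Nat.card K ^ (t + n % t) * ∑ i ∈ range (n / t - 1), (Nat.card K ^ t) ^ i := by
            have hq : 0 < Nat.card K := Nat.card_pos
            refine Nat.mul_pos (by positivity) (sum_pos (fun i _ => by positivity) ?_)
            exact ⟨0, by simp; omega⟩
          omega
        obtain ⟨W, hW, hWB⟩ := exists_mem_ne hT2 B
        exact ⟨W, mem_union_left _ (mem_erase.mpr ⟨hWB, hW⟩), hTd W hW hWB⟩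
      · rcases mem_union.mp hW with h' | h'
        · exact (hTd W (mem_of_mem_erase h') (ne_of_mem_erase h')).le
        · by_cases hWB : W = B'
          · rw [hWB, hBd']; omega
          · rw [hRd W h' hWB]; omega

lemma sigma_le_extremalSize {n t : ℕ} (ht : 1 ≤ t) (htn : t < n) :
    sigma K n t ≤ extremalSize (Nat.card K) n t := by
  obtain ⟨T, hT, hTc, h1, h2⟩ :=
    exists_isPartitionOf_extremalSize (K := K) (V := Fin n → K) (U := ⊤) ht htn (by simp)
  exact Nat.sInf_le ⟨T, hT.isSubspacePartition, h1, h2, hTc⟩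

end Construction

/-! ### Extremal supertails and the two cases of the theorem. -/

section Main

variable {K V : Type*} [Field K] [Finite K] [AddCommGroup V] [Module K V] [FiniteDimensional K V]
  {T : Finset (Submodule K V)}

lemma IsPartialSpread.weight_modEq_of_card_eq (hT : IsPartialSpread T) {d t : ℕ}
    (hdiv : IsDivisible T d) {W : Submodule K V} (hW : W ∈ T) (hWt : finrank K W = t) (htd : t < d)
    (hcard : T.card = Nat.card K ^ t + 1) (f : Dual K V) :
    weight T f ≡ Nat.card K ^ t [MOD Nat.card K ^ d] ∧ Nat.card K ^ t ≤ weight T f := by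
  subst hWt
  obtain ⟨c, hcd, hc⟩ := hdiv.exists_residue
  have := (hT.pow_finrank_lt_card hcd hc hW htd).2 hcard
  subst this
  exact ⟨hc f, by rcases modEq_cases (hc f) hcd with h | h <;> omega⟩

/-- An extremal divisible partial spread with members of a single dimension. -/
lemma IsPartialSpread.finrank_sup_of_forall_eq (hT : IsPartialSpread T) {d t : ℕ}
    (hdiv : IsDivisible T d) (hdim : ∀ W ∈ T, finrank K W = t) (htd : t < d)
    (hcard : T.card = Nat.card K ^ t + 1) : finrank K (T.sup id : Submodule K V) = 2 * t := by
  obtain ⟨W, hW⟩ : T.Nonempty := card_pos.mp (by omega)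
  have h1 := (hT.card_sup_of_le_weight
    (fun f => (hT.weight_modEq_of_card_eq hdiv hW (hdim W hW) htd hcard f).2) hcard.symm).1
  have h2 : weight T 0 = T.card * Nat.card K ^ t := by
    rw [weight_zero, sum_congr rfl fun W hW => by rw [hdim W hW], sum_const, smul_eq_mul]
  refine Nat.pow_right_injective (two_le_card (K := K)) ?_
  rw [h2, hcard, add_mul, one_mul] at h1
  change Nat.card K ^ _ = Nat.card K ^ _
  rw [two_mul, pow_add]
  omega

/-- An extremal divisible partial spread with members of two different dimensions. -/
lemma IsPartialSpread.finrank_sup_of_forall_eq_or (hT : IsPartialSpread T) {d t e : ℕ}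
    (hdiv : IsDivisible T d) (hdim : ∀ W ∈ T, finrank K W = e ∨ finrank K W = t) (het : e < t)
    (htd : t < d) {W₁ W₂ : Submodule K V} (hW₁ : W₁ ∈ T) (hW₁e : finrank K W₁ = e)
    (hW₂ : W₂ ∈ T) (hW₂t : finrank K W₂ = t)
    (hcard : T.card = Nat.card K ^ t + 1) : finrank K (T.sup id : Submodule K V) = t + e := by
  have hmod := hT.weight_modEq_of_card_eq hdiv hW₂ hW₂t htd hcard
  have h1 := (hT.card_sup_of_le_weight (fun f => (hmod f).2) hcard.symm).1
  have hq := two_le_card (K := K)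
  have hmem : W₁ ∈ supertail T t := mem_supertail.mpr ⟨hW₁, by omega⟩
  have hsub : ∀ f : Dual K V, weight (supertail T t) f ≡ 0 [MOD Nat.card K ^ t] := fun f =>
    (weight_supertail_modEq T t f).trans (((hmod f).1.of_dvd (pow_dvd_pow _ htd.le)).trans
      (Nat.modEq_zero_iff_dvd.mpr dvd_rfl))
  -- The residue `q ^ t` vanishes modulo `q ^ t`, so the members of dimension `e` number more than
  -- `q ^ t - q ^ e + 1`. This confines the size of the span to `[q ^ (t + e), 2 * q ^ (t + e))`.
  have h2 := (hT.mono (supertail_subset T t)).lt_card_add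
    (fun f => modEq_cases (hsub f) (by positivity)) hmem (by omega) (by positivity)
  rw [hW₁e] at h2
  have h3 : (supertail T t).card + (T.filter fun W : Submodule K V => ¬ finrank K W < t).card =
      T.card := card_filter_add_card_filter_not _
  have h4 : 0 < (T.filter fun W : Submodule K V => ¬ finrank K W < t).card :=
    card_pos.mpr ⟨W₂, mem_filter.mpr ⟨hW₂, by omega⟩⟩
  have h5 : weight T 0 = (supertail T t).card * Nat.card K ^ e +
      (T.filter fun W : Submodule K V => ¬ finrank K W < t).card * Nat.card K ^ t := by
    rw [weight_zero, ← sum_supertail_add T t, ← smul_eq_mul, ← smul_eq_mul]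
    congr 1
    · refine sum_eq_card_nsmul fun W hW => ?_
      rw [mem_supertail] at hW
      rcases hdim W hW.1 with h | h
      · rw [h]
      · omega
    · refine sum_eq_card_nsmul fun W hW => ?_
      rw [mem_filter] at hW
      rcases hdim W hW.1 with h | h
      · omega
      · rw [h]
  set a := (supertail T t).card
  set b := (T.filter fun W : Submodule K V => ¬ finrank K W < t).card
  have hlt : Nat.card K ^ e < Nat.card K ^ t := Nat.pow_lt_pow_right hq het
  have h6 : Nat.card K ^ (t + e) = Nat.card K ^ t * Nat.card K ^ e := pow_add _ _ _
  have h7 : Nat.card K ^ (t + e) ≤ Nat.card K ^ finrank K (T.sup id : Submodule K V) := by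
    rw [h6]; nlinarith
  have h8 : Nat.card K ^ finrank K (T.sup id : Submodule K V) < Nat.card K ^ (t + e + 1) := by
    have : Nat.card K ^ (t + e) * 2 ≤ Nat.card K ^ (t + e + 1) := by
      rw [pow_succ]; exact Nat.mul_le_mul_left _ hq
    refine lt_of_lt_of_le ?_ this
    rw [h6]; nlinarith
  have h9 := (Nat.pow_le_pow_iff_right hq).mp h7
  have h10 := (Nat.pow_lt_pow_iff_right hq).mp h8
  omega

/-- The case in which the union of the smaller supertail is a subspace of larger dimension. -/
lemma IsPartialSpread.lt_card_of_lt_finrank_sup (hT : IsPartialSpread T) {D d t : ℕ}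
    (hdiv : IsDivisible T D) (hdD : d < D) (hmax : ∀ W ∈ T, finrank K W ≤ d)
    {W U : Submodule K V} (hW : W ∈ T) (hWd : finrank K W = d) (hU : U ∈ T)
    (hUt : finrank K U = t) (htd : t < d) (hcard : (supertail T d).card = Nat.card K ^ t + 1)
    (hsup : d < finrank K ((supertail T d).sup id : Submodule K V)) :
    Nat.card K ^ d + 1 + (Nat.card K ^ t + 1) ≤ T.card := by
  have hq := two_le_card (K := K)
  have hT' := hT.mono (supertail_subset T d)
  have hmod := hT'.weight_modEq_of_card_eq (hdiv.supertail hdD.le)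
    (mem_supertail.mpr ⟨hU, hUt ▸ htd⟩) hUt htd hcard
  have hc := (hT'.card_sup_of_le_weight (fun f => (hmod f).2) hcard.symm).1
  obtain ⟨C, hCD, hC⟩ := hdiv.exists_residue
  have hcases := fun f => modEq_cases (hC f) hCD
  have hClt : C < T.card := hT.lt_card_of_le_weight ⟨W, hW⟩ fun f => by
    rcases hcases f with h | h <;> omega
  have hlt : Nat.card K ^ t < Nat.card K ^ d := Nat.pow_lt_pow_right hq htd
  have hCd : C ≡ Nat.card K ^ t [MOD Nat.card K ^ d] :=
    (((hC 0).of_dvd (pow_dvd_pow _ hdD.le)).symm.trans (weight_supertail_modEq T d 0).symm).trans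
      (hmod 0).1
  have hdD2 : Nat.card K ^ d * 2 ≤ Nat.card K ^ D :=
    calc _ ≤ Nat.card K ^ d * Nat.card K := Nat.mul_le_mul_left _ hq
      _ = Nat.card K ^ (d + 1) := (pow_succ _ _).symm
      _ ≤ _ := Nat.pow_le_pow_right (by omega) hdD
  by_contra! hcon
  -- Either `C = q ^ t`, and a member of dimension `d` forces too many members, or `C = q ^ d + q ^
  -- t` and `#T = C + 1`, leaving exactly `q ^ d` members of dimension `d`.
  rcases modEq_cases hCd hlt with h | h
  · have := hT.lt_card_add hcases hW (by omega) (by rw [hWd]; omega)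
    rw [hWd] at this
    omega
  · have h1 : (supertail T d).card + (T.filter fun W : Submodule K V => ¬ finrank K W < d).card =
        T.card := card_filter_add_card_filter_not _
    have h2 : (T.filter fun W : Submodule K V => ¬ finrank K W < d).card = Nat.card K ^ d := by
      omega
    have h3 : weight T 0 = weight (supertail T d) 0 + Nat.card K ^ d * Nat.card K ^ d := by
      rw [weight_zero, weight_zero, ← sum_supertail_add T d]
      rw [sum_eq_card_nsmul (s := T.filter fun W : Submodule K V => ¬ finrank K W < d)
        (b := Nat.card K ^ d), h2, smul_eq_mul]
      intro W hW
      rw [mem_filter] at hW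
      rw [le_antisymm (hmax W hW.1) (by omega)]
    have h4 : weight T 0 ≡ C [MOD Nat.card K ^ (d + 1)] := (hC 0).of_dvd (pow_dvd_pow _ hdD)
    rw [h3, ← hc, show C = Nat.card K ^ d + Nat.card K ^ t by omega] at h4
    have h5 : Nat.card K ^ finrank K ((supertail T d).sup id : Submodule K V) +
        Nat.card K ^ d * Nat.card K ^ d ≡ Nat.card K ^ d [MOD Nat.card K ^ (d + 1)] :=
      Nat.ModEq.add_right_cancel' (Nat.card K ^ t) (by rwa [add_right_comm])
    -- Both summands are divisible by `q ^ (d + 1)`: the span has dimension above `d`, and `2 * d ≥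
    -- d + 1`.
    have h6 : Nat.card K ^ (d + 1) ∣
        Nat.card K ^ finrank K ((supertail T d).sup id : Submodule K V) +
        Nat.card K ^ d * Nat.card K ^ d := by
      rw [← pow_add]
      exact dvd_add (pow_dvd_pow _ hsup) (pow_dvd_pow _ (by omega))
    have h7 := (h5.dvd_iff dvd_rfl).mp h6
    have h8 := (Nat.pow_dvd_pow_iff_le_right hq).mp h7
    omega

/-- The case in which the smaller supertail can be merged into one subspace. -/
lemma IsPartialSpread.extremalSize_add_card_le (hT : IsPartialSpread T) {D d c : ℕ}
    (hdiv : IsDivisible T D) (hdD : d < D) (hmax : ∀ W ∈ T, finrank K W ≤ d)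
    (hc : ∀ f : Dual K V, c ≤ weight (supertail T d) f) (hcard : c + 1 = (supertail T d).card)
    (hsup : finrank K ((supertail T d).sup id : Submodule K V) = d) :
    extremalSize (Nat.card K) D d + (supertail T d).card ≤ T.card + 1 := by
  classical
  have hT' := hT.mono (supertail_subset T d)
  obtain ⟨h1, h2⟩ := hT'.card_sup_of_le_weight hc hcard
  have hcover : ∀ {v : V}, v ∈ (supertail T d).sup id → v ≠ 0 → ∃ W ∈ supertail T d, v ∈ W :=
    fun hv hv0 => hT'.exists_mem_of_mem_sup (by omega) hv hv0
  set U := (supertail T d).sup id with hU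
  set G := T.filter fun W : Submodule K V => ¬ finrank K W < d with hG
  have hGT : ∀ W ∈ G, W ∈ T := fun W hW => mem_of_mem_filter W hW
  have hdisj : ∀ W ∈ G, Disjoint W U := by
    intro W hW
    rw [Submodule.disjoint_def]
    intro v hvW hvU
    by_contra hv0
    obtain ⟨W', hW', hv'⟩ := hcover hvU hv0
    rw [mem_supertail] at hW'
    have := hT.eq_of_mem (hGT W hW) hW'.1 hv0 hvW hv'
    exact (mem_filter.mp hW).2 (this ▸ hW'.2)
  have hUne : U ≠ ⊥ := by
    obtain ⟨W, hW⟩ : (supertail T d).Nonempty := card_pos.mp (by omega)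
    exact ne_bot_of_le_ne_bot (hT'.ne_bot W hW) (le_sup (f := id) hW)
  have hUG : U ∉ G := fun h => hUne (disjoint_self.mp (hdisj U h))
  have hS : IsPartialSpread (insert U G) := by
    constructor
    · intro W hW
      rcases mem_insert.mp hW with rfl | h
      · exact hUne
      · exact hT.ne_bot W (hGT W h)
    · intro W hW W' hW' hne
      rcases mem_insert.mp hW with h | h <;> rcases mem_insert.mp hW' with h' | h'
      · exact absurd (h.trans h'.symm) hne
      · rw [h]; exact (hdisj W' h').symm
      · rw [h']; exact hdisj W h
      · exact hT.disjoint W (hGT W h) W' (hGT W' h') hne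
  -- The two-weight property says that the supertail has the weight of its span `U` plus the
  -- constant `c`.
  have hw : ∀ f : Dual K V, weight (insert U G) f + c = weight T f := by
    intro f
    have h3 : weight (supertail T d) f = blockWeight U f + c := by
      by_cases hf : f ∈ U.dualAnnihilator
      · rw [(weight_eq_weight_zero_iff _ f).mpr hf, blockWeight_of_mem hf, h1]
      · rw [h2 f hf, blockWeight, if_neg hf, zero_add]
    have h4 : weight (supertail T d) f + weight G f = weight T f := sum_supertail_add T d _
    have h5 : weight (insert U G) f = blockWeight U f + weight G f := sum_insert hUG
    omega
  have hSdiv : IsDivisible (insert U G) D := fun f =>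
    Nat.ModEq.add_right_cancel' c (by rw [hw, hw]; exact hdiv f)
  have hbound := hS.extremalSize_le hSdiv (t := d) (by
    intro W hW
    rcases mem_insert.mp hW with rfl | h
    · exact hsup.le
    · exact hmax W (hGT W h)) (mem_insert_self U G) hsup hdD
  rw [card_insert_of_notMem hUG] at hbound
  have h3 : (supertail T d).card + G.card = T.card := card_filter_add_card_filter_not _
  omega

end Main

end SubspacePartition

/-! ### The theorem. -/

theorem mainTheorem2 {K V : Type*} [Field K] [Finite K] [AddCommGroup V] [Module K V]
    [FiniteDimensional K V] (P : Finset (Submodule K V))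
    (hP : SubspacePartition.IsSubspacePartition P)
    (m : ℕ) (d : ℕ → ℕ) (hd : SubspacePartition.HasDimensions P m d)
    (s : ℕ) (hs : 2 ≤ s) (hsm : s < m)
    (hST : (SubspacePartition.supertail P (d s)).card =
      SubspacePartition.sigma K (d s) (d (s - 1))) :
    (s ≤ 3 → d s < 2 * d (s - 1) → d (s + 1) < 2 * d s → ¬ (s = 3 ∧ d 3 = d 2 + d 1) →
      SubspacePartition.sigma K (d (s + 1)) (d s) + SubspacePartition.sigma K (d s) (d (s - 1)) ≤
        (SubspacePartition.supertail P (d (s + 1))).card) ∧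
    ((2 * d (s - 1) ≤ d s ∨ (s = 3 ∧ d 3 = d 2 + d 1)) →
      SubspacePartition.sigma K (d (s + 1)) (d s) +
          SubspacePartition.sigma K (d s) (d (s - 1)) - 1 ≤
        (SubspacePartition.supertail P (d (s + 1))).card) := by
  have hocc : ∀ i, 1 ≤ i → i ≤ m → ∃ W ∈ P, Module.finrank K W = d i := fun i h1 h2 =>
    (hd.occurs_iff _).mpr ⟨i, ⟨h1, h2⟩, rfl⟩
  have hmono : ∀ i j, 1 ≤ i → j ≤ m → i < j → d i < d j := fun i j h1 h2 h =>
    hd.strictMonoOn ⟨h1, by omega⟩ ⟨by omega, h2⟩ h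
  have hdims : ∀ W ∈ P, ∃ i, 1 ≤ i ∧ i ≤ m ∧ d i = Module.finrank K W := fun W hW => by
    obtain ⟨i, hi, h⟩ := (hd.occurs_iff _).mp ⟨W, hW, rfl⟩
    exact ⟨i, hi.1, hi.2, h⟩
  have hbelow : ∀ j, 1 ≤ j → j ≤ m → ∀ W ∈ SubspacePartition.supertail P (d j),
      ∃ i, 1 ≤ i ∧ i < j ∧ d i = Module.finrank K W := by
    intro j hj hjm W hW
    rw [SubspacePartition.mem_supertail] at hW
    obtain ⟨i, h1, h2, h⟩ := hdims W hW.1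
    refine ⟨i, h1, ?_, h⟩
    by_contra! hji
    rcases hji.eq_or_lt with rfl | hlt
    · omega
    · have := hmono j i hj h2 hlt
      omega
  have hmax : ∀ j, 1 ≤ j → j < m → ∀ W ∈ SubspacePartition.supertail P (d (j + 1)),
      Module.finrank K W ≤ d j := by
    intro j hj hjm W hW
    obtain ⟨i, h1, h2, h⟩ := hbelow (j + 1) (by omega) hjm W hW
    rcases (Nat.lt_succ_iff.mp h2).eq_or_lt with rfl | hlt
    · exact h.ge
    · exact h ▸ (hmono i j h1 (by omega) hlt).le
  have hle : ∀ j, 1 ≤ j → j ≤ m → d j ≤ Module.finrank K V := fun j h1 h2 => by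
    obtain ⟨W, -, h⟩ := hocc j h1 h2
    exact h ▸ Submodule.finrank_le W
  obtain ⟨r, rfl⟩ : ∃ r, s = r + 1 := ⟨s - 1, by omega⟩
  rw [Nat.add_sub_cancel] at *
  have hrs := hmono r (r + 1) (by omega) (by omega) (by omega)
  have hsD := hmono (r + 1) (r + 1 + 1) (by omega) (by omega) (by omega)
  obtain ⟨Wt, hWt, hWtd⟩ := hocc r (by omega) (by omega)
  obtain ⟨Wd, hWd, hWdd⟩ := hocc (r + 1) (by omega) (by omega)
  have hspread := hP.isPartialSpread
  have hTdiv := hP.isDivisible_supertail (hle (r + 1) (by omega) (by omega))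
  have hT := hspread.mono (SubspacePartition.supertail_subset P (d (r + 1)))
  have hWtT : Wt ∈ SubspacePartition.supertail P (d (r + 1)) :=
    SubspacePartition.mem_supertail.mpr ⟨hWt, by omega⟩
  have hTmax := hmax r (by omega) (by omega)
  have hdr : 1 ≤ d r := hWtd ▸ Submodule.one_le_finrank_iff.mpr (hP.ne_bot Wt hWt)
  -- Only `sigma ≤ extremalSize` is needed: with the hypothesis on the supertail and its lower bound
  -- this is an equality.
  have hcard : (SubspacePartition.supertail P (d (r + 1))).card =
      SubspacePartition.extremalSize (Nat.card K) (d (r + 1)) (d r) :=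
    le_antisymm (hST ▸ SubspacePartition.sigma_le_extremalSize hdr hrs)
      (hT.extremalSize_le hTdiv hTmax hWtT hWtd hrs)
  have hsigma := SubspacePartition.sigma_le_extremalSize (K := K) (hdr.trans hrs.le) hsD
  have hT2 := hspread.mono (SubspacePartition.supertail_subset P (d (r + 1 + 1)))
  have hT2div := hP.isDivisible_supertail (hle (r + 1 + 1) (by omega) (by omega))
  have hT2max := hmax (r + 1) (by omega) (by omega)
  have hsub : SubspacePartition.supertail (SubspacePartition.supertail P (d (r + 1 + 1)))
      (d (r + 1)) = SubspacePartition.supertail P (d (r + 1)) := by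
    ext W
    simp only [SubspacePartition.mem_supertail, and_assoc, and_congr_right_iff]
    intro _
    omega
  have hthree : r + 1 = 3 → d (r + 1) < 2 * d r →
      Module.finrank K ((SubspacePartition.supertail P (d (r + 1))).sup id : Submodule K V) =
        d 2 + d 1 := by
    intro hr hlt
    obtain rfl : r = 2 := by omega
    rw [SubspacePartition.extremalSize_of_lt hlt] at hcard
    have h12 := hmono 1 2 le_rfl (by omega) (by omega)
    obtain ⟨W₁, hW₁, hW₁d⟩ := hocc 1 le_rfl (by omega)
    refine hT.finrank_sup_of_forall_eq_or hTdiv (fun W hW => ?_) h12 hrs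
      (SubspacePartition.mem_supertail.mpr ⟨hW₁, by omega⟩) hW₁d hWtT hWtd hcard
    obtain ⟨i, h1, h2, h⟩ := hbelow (2 + 1) (by omega) (by omega) W hW
    obtain rfl | rfl : i = 1 ∨ i = 2 := by omega
    · exact Or.inl h.symm
    · exact Or.inr h.symm
  constructor
  · intro hs3 hlt hlt2 hne
    rw [SubspacePartition.extremalSize_of_lt hlt2] at hsigma
    have hcard' := hcard
    rw [SubspacePartition.extremalSize_of_lt hlt] at hcard'
    have hsup : d (r + 1) <
        Module.finrank K ((SubspacePartition.supertail P (d (r + 1))).sup id : Submodule K V) := by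
      obtain rfl | rfl : r = 1 ∨ r = 2 := by omega
      · rwa [hT.finrank_sup_of_forall_eq hTdiv (fun W hW => ?_) hrs hcard']
        obtain ⟨i, h1, h2, h⟩ := hbelow (1 + 1) (by omega) (by omega) W hW
        obtain rfl : i = 1 := by omega
        exact h.symm
      · have hmod := hT.weight_modEq_of_card_eq hTdiv hWtT hWtd hrs hcard'
        have hTs := (hT.card_sup_of_le_weight (fun f => (hmod f).2) hcard'.symm).1
        have hq := SubspacePartition.two_le_card (K := K)
        have hpos : 0 < Nat.card K ^ Module.finrank K
            ((SubspacePartition.supertail P (d (2 + 1))).sup id : Submodule K V) := by positivity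
        -- The size of the span is the total weight minus `q ^ d 2`, a positive multiple of `q ^ d
        -- 3`; equality of dimensions is the excluded case `d 3 = d 2 + d 1`.
        refine lt_of_le_of_ne ((Nat.pow_le_pow_iff_right hq).mp ?_) fun heq =>
          hne ⟨rfl, heq.trans (hthree rfl hlt)⟩
        rcases SubspacePartition.modEq_cases (hmod 0).1 (Nat.pow_lt_pow_right hq hrs) with h | h <;>
          omega
    have := hT2.lt_card_of_lt_finrank_sup hT2div hsD hT2max
      (SubspacePartition.mem_supertail.mpr ⟨hWd, by omega⟩) hWdd
      (SubspacePartition.mem_supertail.mpr ⟨hWt, by omega⟩) hWtd hrs (hsub ▸ hcard')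
      (by rw [hsub]; exact hsup)
    omega
  · intro h
    have : ∃ c, (∀ f : Module.Dual K V,
        c ≤ SubspacePartition.weight (SubspacePartition.supertail P (d (r + 1))) f) ∧
        c + 1 = (SubspacePartition.supertail P (d (r + 1))).card ∧
        Module.finrank K ((SubspacePartition.supertail P (d (r + 1))).sup id : Submodule K V) =
          d (r + 1) := by
      rcases lt_or_ge (d (r + 1)) (2 * d r) with hlt | hge
      · obtain ⟨h3, h4⟩ := h.resolve_left (by omega)
        have hcard' := hcard
        rw [SubspacePartition.extremalSize_of_lt hlt] at hcard'
        exact ⟨_, fun f => (hT.weight_modEq_of_card_eq hTdiv hWtT hWtd hrs hcard' f).2,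
          hcard'.symm, by rw [hthree h3 hlt, h3, h4]⟩
      · exact (hT.extremalSize_le_of_two_mul_le hTdiv hTmax hWtT hWtd hge).2 hcard
    obtain ⟨c, hc, hc1, hsup⟩ := this
    have := hT2.extremalSize_add_card_le hT2div hsD hT2max (by rw [hsub]; exact hc)
      (by rw [hsub]; exact hc1) (by rw [hsub]; exact hsup)
    rw [hsub] at this
    omega
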